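/- Let $k$ be a field of characteristic zero, let $q\in k\setminus\{0,1\}$, and let $a\in k[h]$ be any polynomial. Let $\sigma_q$ be the automorphism of the $k$-algebra $k[h]$ with $\sigma_q(h)=qh$, and let $\Lambda=\Lambda(k[h],\sigma_q,a)$ be the quantum generalized Weyl algebra (Bavula algebra): the $k$-algebra generated by $k[h]$ and two variables $x,y$ subject to the relations $$yx=a,\qquad xy=\sigma_q(a),\qquad xr=\sigma_q(r)x,\qquad ry=y\sigma_q(r)\qquad\text{for all } r\in k[h].$$ Let $\operatorname{gldim}\Lambda$ denote the (left) global dimension of $\Lambda$, that is, the supremum of the projective dimensions of all left $\Lambda$-modules. Then $$\operatorname{gldim}\Lambda<\infty\ \Longrightarrow\ \operatorname{gldim}\Lambda=2.$$ -/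

import Mathlib

open Polynomial CategoryTheory

universe u v

/-- The left global dimension of a ring: the supremum of the projective dimensions of
all its left modules. It is `⊤` when this supremum is infinite, and `⊥` for the zero ring. -/
noncomputable def globalDimension (A : Type u) [Ring A] : WithBot ℕ∞ :=
  ⨆ M : ModuleCat.{u} A, projectiveDimension M

/-- The generators of a Bavula algebra: the elements of `R` and two letters `x`, `y`. -/
inductive BavulaGen (R : Type v) : Type v
  | coeff (r : R) : BavulaGen R
  | x : BavulaGen R
  | y : BavulaGen R

section Bavula

variable {k : Type u} {R : Type v} [CommRing k] [Ring R] [Algebra k R]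

/-- The letter `x` in the free algebra on the generators. -/
def BavulaGen.freeX (k : Type u) (R : Type v) [CommRing k] : FreeAlgebra k (BavulaGen R) :=
  FreeAlgebra.ι k BavulaGen.x

/-- The letter `y` in the free algebra on the generators. -/
def BavulaGen.freeY (k : Type u) (R : Type v) [CommRing k] : FreeAlgebra k (BavulaGen R) :=
  FreeAlgebra.ι k BavulaGen.y

/-- The generator of the free algebra attached to an element of `R`. -/
def BavulaGen.freeCoeff (k : Type u) {R : Type v} [CommRing k] (r : R) :
    FreeAlgebra k (BavulaGen R) :=
  FreeAlgebra.ι k (BavulaGen.coeff r)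

open BavulaGen in
/-- The defining relations of `Λ(R, σ, a)`. The first three say that `R → Λ(R, σ, a)` is a
homomorphism of `k`-algebras, and the others are
`y x = a`, `x y = σ(a)`, `x r = σ(r) x` and `r y = y σ(r)` for all `r` in `R`. -/
inductive BavulaRel (σ : R ≃ₐ[k] R) (a : R) :
    FreeAlgebra k (BavulaGen R) → FreeAlgebra k (BavulaGen R) → Prop
  | map_add (r s : R) :
      BavulaRel σ a (freeCoeff k (r + s)) (freeCoeff k r + freeCoeff k s)
  | map_mul (r s : R) :
      BavulaRel σ a (freeCoeff k (r * s)) (freeCoeff k r * freeCoeff k s)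
  | map_algebraMap (c : k) :
      BavulaRel σ a (freeCoeff k (algebraMap k R c)) (algebraMap k _ c)
  | y_mul_x : BavulaRel σ a (freeY k R * freeX k R) (freeCoeff k a)
  | x_mul_y : BavulaRel σ a (freeX k R * freeY k R) (freeCoeff k (σ a))
  | x_mul_coeff (r : R) :
      BavulaRel σ a (freeX k R * freeCoeff k r) (freeCoeff k (σ r) * freeX k R)
  | coeff_mul_y (r : R) :
      BavulaRel σ a (freeCoeff k r * freeY k R) (freeY k R * freeCoeff k (σ r))

/-- The Bavula algebra (generalized Weyl algebra) `Λ(R, σ, a)`: the `k`-algebra generated by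
`R` and two variables `x`, `y` subject to the relations above. -/
def BavulaAlgebra (σ : R ≃ₐ[k] R) (a : R) : Type (max u v) :=
  RingQuot (BavulaRel σ a)

noncomputable instance (σ : R ≃ₐ[k] R) (a : R) : Ring (BavulaAlgebra σ a) :=
  inferInstanceAs (Ring (RingQuot (BavulaRel σ a)))

noncomputable instance (σ : R ≃ₐ[k] R) (a : R) : Algebra k (BavulaAlgebra σ a) :=
  inferInstanceAs (Algebra k (RingQuot (BavulaRel σ a)))

end Bavula

/-- The automorphism `σ_q` of the `k`-algebra `k[h]` with `σ_q(h) = q h`, for `q ≠ 0`. -/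
noncomputable def sigmaQ {k : Type u} [Field k] (q : k) (hq : q ≠ 0) : k[X] ≃ₐ[k] k[X] :=
  AlgEquiv.ofAlgHom (aeval (C q * X)) (aeval (C q⁻¹ * X))
    (by
      ext
      simp [← mul_assoc, ← C_mul, hq])
    (by
      ext
      simp [← mul_assoc, ← C_mul, hq])

/-! Upper bound. Write Λ for the algebra over R = k[h]. Inducing M up to Λ gives a complex 0 → Λ⊗M →
(Λ⊗M twisted by σ⁻¹) ⊕ (Λ⊗M twisted by σ) → Λ⊗M → M → 0 with maps `rel`, `diff`, `augmentation`. It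
is exact except in the middle, where the homology is a copy of M. With K = ker `augmentation` and C
= coker `rel` this yields 0 → K → Λ⊗M → M → 0 and 0 → M → C → K → 0, the two-step periodicity
familiar from hypersurfaces. If M is projective over R, the induced modules are projective and pd C
≤ 1, so a finite pd M can be lowered by two until it is at most 1
(`hasProjectiveDimensionLT_of_projective_coeff`). Over a PID every Λ-module N is a quotient of some
Λ⊗P, with P free over R, by a kernel that is again projective over R; hence pd N ≤ 2
(`globalDimension_le_two`).

Lower bound. The point h = 0 is fixed by σ_q, which gives a character with h ↦ 0, x ↦ 1. If its
kernel I were projective, the relation (x − q)h = h·q(x − 1) would force every coordinate of a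
splitting at h to lie in hΛ (`exists_eq_coeff_X_mul`). Cancelling h would put 1 in I. So Λ/I has
projective dimension at least 2. -/

/-! ### The Bavula algebra: structure maps and universal property -/

namespace BavulaAlgebra

section Basic

variable {k : Type u} {R : Type v} [CommRing k] [Ring R] [Algebra k R] (σ : R ≃ₐ[k] R) (a : R)

/-- The quotient map from the free algebra. -/
noncomputable def ofFree : FreeAlgebra k (BavulaGen R) →ₐ[k] BavulaAlgebra σ a :=
  RingQuot.mkAlgHom k (BavulaRel σ a)

variable {σ a} in
theorem ofFree_eq {p q : FreeAlgebra k (BavulaGen R)} (h : BavulaRel σ a p q) :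
    ofFree σ a p = ofFree σ a q :=
  RingQuot.mkAlgHom_rel k h

/-- The structure map `R → Λ(R, σ, a)`. -/
noncomputable def coeff : R →ₐ[k] BavulaAlgebra σ a :=
  AlgHom.ofLinearMap
    { toFun := fun r => ofFree σ a (BavulaGen.freeCoeff k r)
      map_add' := fun r s => by rw [ofFree_eq (.map_add r s), map_add]
      map_smul' := fun c r => by
        rw [Algebra.smul_def, ofFree_eq (.map_mul _ r), ofFree_eq (.map_mul _ r) |>.symm,
          ofFree_eq (.map_mul _ r), map_mul, ofFree_eq (.map_algebraMap c), AlgHom.commutes,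
          RingHom.id_apply, Algebra.smul_def] }
    (by
      have := ofFree_eq (BavulaRel.map_algebraMap (σ := σ) (a := a) 1)
      simpa using this)
    (fun r s => by
      have := ofFree_eq (BavulaRel.map_mul (σ := σ) (a := a) r s)
      simpa using this)

/-- The generator `x` of the Bavula algebra. -/
noncomputable def x : BavulaAlgebra σ a := ofFree σ a (BavulaGen.freeX k R)

/-- The generator `y` of the Bavula algebra. -/
noncomputable def y : BavulaAlgebra σ a := ofFree σ a (BavulaGen.freeY k R)

theorem y_mul_x : y σ a * x σ a = coeff σ a a := by
  have := ofFree_eq (BavulaRel.y_mul_x (σ := σ) (a := a))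
  rwa [map_mul] at this

theorem x_mul_y : x σ a * y σ a = coeff σ a (σ a) := by
  have := ofFree_eq (BavulaRel.x_mul_y (σ := σ) (a := a))
  rwa [map_mul] at this

theorem x_mul_coeff (r : R) : x σ a * coeff σ a r = coeff σ a (σ r) * x σ a := by
  have := ofFree_eq (BavulaRel.x_mul_coeff (σ := σ) (a := a) r)
  rwa [map_mul, map_mul] at this

theorem coeff_mul_y (r : R) : coeff σ a r * y σ a = y σ a * coeff σ a (σ r) := by
  have := ofFree_eq (BavulaRel.coeff_mul_y (σ := σ) (a := a) r)
  rwa [map_mul, map_mul] at this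

variable {σ a} in
/-- To prove something for all elements of the Bavula algebra, it suffices to treat the generators,
sums and products. -/
theorem induction {p : BavulaAlgebra σ a → Prop} (hr : ∀ r, p (coeff σ a r)) (hx : p (x σ a))
    (hy : p (y σ a)) (hadd : ∀ b c, p b → p c → p (b + c)) (hmul : ∀ b c, p b → p c → p (b * c))
    (b : BavulaAlgebra σ a) : p b := by
  obtain ⟨f, rfl⟩ := RingQuot.mkAlgHom_surjective k (BavulaRel σ a) b
  change p (ofFree σ a f)
  induction f using FreeAlgebra.induction with
  | grade0 c =>
    have := hr (algebraMap k R c)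
    rwa [AlgHom.commutes, ← (ofFree σ a).commutes c] at this
  | grade1 g =>
    cases g with
    | coeff r => exact hr r
    | x => exact hx
    | y => exact hy
  | mul f g hf hg => rw [map_mul]; exact hmul _ _ hf hg
  | add f g hf hg => rw [map_add]; exact hadd _ _ hf hg

section Lift

variable {A : Type*} [Ring A] [Algebra k A] (f : R →ₐ[k] A) (X Y : A)

/-- The images of the generators under the lift of `(f, X, Y)`. -/
def liftGen : BavulaGen R → A
  | .coeff r => f r
  | .x => X
  | .y => Y

/-- The universal property of the Bavula algebra. -/
noncomputable def lift (hyx : Y * X = f a) (hxy : X * Y = f (σ a))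
    (hxr : ∀ r, X * f r = f (σ r) * X) (hry : ∀ r, f r * Y = Y * f (σ r)) :
    BavulaAlgebra σ a →ₐ[k] A :=
  RingQuot.liftAlgHom k ⟨FreeAlgebra.lift k (liftGen f X Y), fun p q h => by
    cases h <;>
      simp [BavulaGen.freeCoeff, BavulaGen.freeX, BavulaGen.freeY, liftGen, hyx, hxy, hxr, hry]⟩

variable {f X Y} (hyx : Y * X = f a) (hxy : X * Y = f (σ a))
    (hxr : ∀ r, X * f r = f (σ r) * X) (hry : ∀ r, f r * Y = Y * f (σ r))

@[simp]
theorem lift_coeff (r : R) : lift σ a f X Y hyx hxy hxr hry (coeff σ a r) = f r := by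
  refine (RingQuot.liftAlgHom_mkAlgHom_apply k _ _ _).trans ?_
  simp [BavulaGen.freeCoeff, liftGen]

@[simp]
theorem lift_x : lift σ a f X Y hyx hxy hxr hry (x σ a) = X := by
  refine (RingQuot.liftAlgHom_mkAlgHom_apply k _ _ _).trans ?_
  simp [BavulaGen.freeX, liftGen]

@[simp]
theorem lift_y : lift σ a f X Y hyx hxy hxr hry (y σ a) = Y := by
  refine (RingQuot.liftAlgHom_mkAlgHom_apply k _ _ _).trans ?_
  simp [BavulaGen.freeY, liftGen]

end Lift

section LinearMap

variable {σ a} {V W : Type*} [AddCommGroup V] [AddCommGroup W] [Module (BavulaAlgebra σ a) V]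
  [Module (BavulaAlgebra σ a) W]

/-- An additive map that commutes with the generators is linear. -/
def linearMapOfGenerators (f : V →+ W) (hr : ∀ r v, f (coeff σ a r • v) = coeff σ a r • f v)
    (hx : ∀ v, f (x σ a • v) = x σ a • f v) (hy : ∀ v, f (y σ a • v) = y σ a • f v) :
    V →ₗ[BavulaAlgebra σ a] W where
  __ := f
  map_smul' b v := by
    change f (b • v) = b • f v
    induction b using induction generalizing v with
    | hr r => exact hr r v
    | hx => exact hx v
    | hy => exact hy v
    | hadd b c hb hc => rw [add_smul, map_add, hb, hc, add_smul]
    | hmul b c hb hc => rw [mul_smul, hb, hc, mul_smul]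

end LinearMap

end Basic

/-! ### Monomials in x and y and their multiplication rules. -/

section Monomial

variable {k : Type u} {R : Type v} [CommRing k] [Ring R] [Algebra k R] (σ : R ≃ₐ[k] R) (a : R)

/-- The monomial `x ^ n` for `0 ≤ n`, and `y ^ (-n)` for `n ≤ 0`. -/
noncomputable def monomial (n : ℤ) : BavulaAlgebra σ a :=
  if 0 ≤ n then x σ a ^ n.toNat else y σ a ^ (-n).toNat

theorem monomial_natCast (n : ℕ) : monomial σ a n = x σ a ^ n := by
  simp [monomial]

theorem monomial_neg_natCast (n : ℕ) : monomial σ a (-n) = y σ a ^ n := by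
  rcases Nat.eq_zero_or_pos n with rfl | hn
  · simp [monomial]
  · rw [monomial, if_neg (by lia)]; simp

@[simp]
theorem monomial_zero : monomial σ a 0 = 1 := by simp [monomial]

theorem monomial_add_one {n : ℤ} (hn : 0 ≤ n) :
    monomial σ a (n + 1) = monomial σ a n * x σ a := by
  lift n to ℕ using hn
  rw [← Nat.cast_succ, monomial_natCast, monomial_natCast, pow_succ]

theorem monomial_sub_one {n : ℤ} (hn : n ≤ 0) :
    monomial σ a (n - 1) = monomial σ a n * y σ a := by
  obtain ⟨m, rfl⟩ : ∃ m : ℕ, n = -m := ⟨n.natAbs, by lia⟩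
  rw [show (-(m : ℤ) - 1) = -((m + 1 : ℕ) : ℤ) by lia, monomial_neg_natCast, monomial_neg_natCast,
    pow_succ]

theorem x_mul_monomial_of_nonneg {n : ℤ} (hn : 0 ≤ n) :
    x σ a * monomial σ a n = monomial σ a (n + 1) := by
  lift n to ℕ using hn
  rw [← Nat.cast_succ, monomial_natCast, monomial_natCast, pow_succ']

theorem y_mul_monomial_of_nonpos {n : ℤ} (hn : n ≤ 0) :
    y σ a * monomial σ a n = monomial σ a (n - 1) := by
  obtain ⟨m, rfl⟩ : ∃ m : ℕ, n = -m := ⟨n.natAbs, by lia⟩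
  rw [show (-(m : ℤ) - 1) = -((m + 1 : ℕ) : ℤ) by lia, monomial_neg_natCast, monomial_neg_natCast,
    pow_succ']

theorem coeff_mul_x (r : R) : coeff σ a r * x σ a = x σ a * coeff σ a (σ.symm r) := by
  rw [x_mul_coeff, AlgEquiv.apply_symm_apply]

/-- Coefficients are always collected on the right of a monomial, so that they can later be moved
onto M in Λ⊗M; passing the degree-n monomial costs σ^(-n). -/
theorem coeff_mul_monomial (r : R) (n : ℤ) :
    coeff σ a r * monomial σ a n = monomial σ a n * coeff σ a ((σ ^ (-n)) r) := by
  obtain ⟨m, rfl | rfl⟩ := n.eq_nat_or_neg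
  · induction m generalizing r with
    | zero => simp
    | succ m ih =>
      rw [Nat.cast_succ, ← x_mul_monomial_of_nonneg σ a (by lia), ← mul_assoc, coeff_mul_x,
        mul_assoc, ih, ← mul_assoc, neg_add, zpow_add, AlgEquiv.mul_apply]
      rfl
  · induction m generalizing r with
    | zero => simp
    | succ m ih =>
      rw [show -((m + 1 : ℕ) : ℤ) = -(m : ℤ) - 1 by lia,
        ← y_mul_monomial_of_nonpos σ a (by lia), ← mul_assoc, coeff_mul_y,
        mul_assoc, ih, ← mul_assoc, neg_sub, sub_eq_add_neg, add_comm, zpow_add,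
        AlgEquiv.mul_apply, zpow_one]

theorem x_mul_monomial_of_neg {n : ℤ} (hn : n < 0) :
    x σ a * monomial σ a n = monomial σ a (n + 1) * coeff σ a ((σ ^ (-n)) a) := by
  have h := y_mul_monomial_of_nonpos σ a (n := n + 1) (by lia)
  rw [add_sub_cancel_right] at h
  rw [← h, ← mul_assoc, x_mul_y, coeff_mul_monomial, ← AlgEquiv.mul_apply, ← zpow_add_one]
  congr 4
  lia

theorem y_mul_monomial_of_pos {n : ℤ} (hn : 0 < n) :
    y σ a * monomial σ a n = monomial σ a (n - 1) * coeff σ a ((σ ^ (1 - n)) a) := by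
  have h := x_mul_monomial_of_nonneg σ a (n := n - 1) (by lia)
  rw [sub_add_cancel] at h
  rw [← h, ← mul_assoc, y_mul_x, coeff_mul_monomial, neg_sub]

end Monomial

end BavulaAlgebra

/-! ### Induced modules -/

/-- The module over the Bavula algebra `Λ(R, σ, a)` induced from the twist of the `R`-module `M` by
`σ ^ j`. It is the direct sum of the groups `e n M`, where `e n` stands for `x ^ n` if `0 ≤ n` and
for `y ^ (-n)` if `n ≤ 0`, and `r • e 0 m = e 0 (σ ^ j r • m)` for `r` in `R`. -/
def BavulaInduced {k : Type u} {R : Type v} [CommRing k] [CommRing R] [Algebra k R]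
    (_σ : R ≃ₐ[k] R) (_a : R) (_j : ℤ) (M : Type*) [AddCommGroup M] : Type _ := ℤ →₀ M

namespace BavulaInduced

/-! ### Weighted shift operators, the building blocks of the action. -/

section WeightedShift

variable (k : Type*) {R M : Type*} [CommRing k] [CommRing R] [Algebra k R] [AddCommGroup M]
  [Module k M] [Module R M] [IsScalarTower k R M]

/-- The endomorphism of `ℤ →₀ M` that shifts degrees by `s` and multiplies by the weights `c`. -/
noncomputable def weightedShift (s : ℤ) (c : ℤ → R) : Module.End k (ℤ →₀ M) :=
  Finsupp.lsum k fun n => Finsupp.lsingle (n + s) ∘ₗ Algebra.lsmul k k M (c n)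

@[simp]
theorem weightedShift_single (s : ℤ) (c : ℤ → R) (n : ℤ) (m : M) :
    weightedShift k s c (Finsupp.single n m) = Finsupp.single (n + s) (c n • m) := by
  simp [weightedShift]

end WeightedShift

variable {k : Type u} {R : Type v} [CommRing k] [CommRing R] [Algebra k R]
  (σ : R ≃ₐ[k] R) (a : R) (j : ℤ) (M : Type*) [AddCommGroup M]

noncomputable instance : AddCommGroup (BavulaInduced σ a j M) :=
  inferInstanceAs (AddCommGroup (ℤ →₀ M))

variable {M} in
/-- The element `e n m` of an induced module. -/
noncomputable def e (n : ℤ) : M →+ BavulaInduced σ a j M := Finsupp.singleAddHom n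

variable {M} in
/-- The coordinate of degree `n` of an element of an induced module. -/
def coord (n : ℤ) : BavulaInduced σ a j M →+ M := Finsupp.applyAddHom n

variable {M σ a j}

theorem coord_e (n i : ℤ) (m : M) : coord σ a j i (e σ a j n m) = if n = i then m else 0 :=
  Finsupp.single_apply

@[simp]
theorem coord_e_self (n : ℤ) (m : M) : coord σ a j n (e σ a j n m) = m := by simp [coord_e]

theorem ext_coord {v w : BavulaInduced σ a j M} (h : ∀ n, coord σ a j n v = coord σ a j n w) :
    v = w := Finsupp.ext h

/-- The coordinates vanish outside of a bounded range. -/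
theorem exists_coord_eq_zero (v : BavulaInduced σ a j M) :
    ∃ b : ℕ, ∀ n : ℤ, b ≤ |n| → coord σ a j n v = 0 := by
  refine ⟨(Finsupp.support v).sup Int.natAbs + 1, fun n hn => ?_⟩
  by_contra h
  have := Finset.le_sup (f := Int.natAbs) (Finsupp.mem_support_iff.mpr h)
  rw [Int.abs_eq_natAbs] at hn
  lia

/-- Finite support makes the coordinates vanish far out, and the hypothesis carries this vanishing
down to degree 0. -/
theorem coord_eq_zero_of_nonneg {v : BavulaInduced σ a j M}
    (h : ∀ n, 0 ≤ n → coord σ a j (n + 1) v = 0 → coord σ a j n v = 0) (n : ℤ) (hn : 0 ≤ n) :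
    coord σ a j n v = 0 := by
  obtain ⟨b, hb⟩ := exists_coord_eq_zero v
  have key : ∀ i : ℕ, ∀ n : ℤ, 0 ≤ n → b ≤ n + i → coord σ a j n v = 0 := by
    intro i
    induction i with
    | zero => intro n hn hb'; exact hb n (by rw [abs_of_nonneg hn]; lia)
    | succ i ih => intro n hn hb'; exact h n hn (ih (n + 1) (by lia) (by lia))
  exact key b n hn (by lia)

theorem coord_eq_zero_of_nonpos {v : BavulaInduced σ a j M}
    (h : ∀ n, n ≤ 0 → coord σ a j (n - 1) v = 0 → coord σ a j n v = 0) (n : ℤ) (hn : n ≤ 0) :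
    coord σ a j n v = 0 := by
  obtain ⟨b, hb⟩ := exists_coord_eq_zero v
  have key : ∀ i : ℕ, ∀ n : ℤ, n ≤ 0 → b ≤ -n + i → coord σ a j n v = 0 := by
    intro i
    induction i with
    | zero => intro n hn hb'; exact hb n (by rw [abs_of_nonpos hn]; lia)
    | succ i ih => intro n hn hb'; exact h n hn (ih (n - 1) (by lia) (by lia))
  exact key b n hn (by lia)

/-- The additive map given by additive maps on the summands. -/
noncomputable def addLift {A : Type*} [AddCommGroup A] (φ : ℤ → M →+ A) :
    BavulaInduced σ a j M →+ A := Finsupp.liftAddHom φ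

@[simp]
theorem addLift_e {A : Type*} [AddCommGroup A] (φ : ℤ → M →+ A) (n : ℤ) (m : M) :
    addLift φ (e σ a j n m) = φ n m := Finsupp.liftAddHom_apply_single _ _ _

theorem induction_e {p : BavulaInduced σ a j M → Prop} (v : BavulaInduced σ a j M)
    (hadd : ∀ v w, p v → p w → p (v + w)) (he : ∀ n m, p (e σ a j n m)) : p v :=
  have h : p 0 := by simpa using he 0 0
  Finsupp.induction_linear v h hadd he

section Module

variable (σ a j M)

/-- The action of the Bavula algebra on an induced module. -/
noncomputable def action [Module k M] [Module R M] [IsScalarTower k R M] :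
    BavulaAlgebra σ a →ₐ[k] Module.End k (ℤ →₀ M) :=
  BavulaAlgebra.lift σ a
    (AlgHom.ofLinearMap
      { toFun := fun r => weightedShift k 0 fun n => (σ ^ (j - n)) r
        map_add' := fun r s => by ext; simp [add_smul]
        map_smul' := fun c r => by ext; simp }
      (by ext; simp) (fun r s => by ext; simp [mul_smul]))
    -- The weights are the right-hand coefficients in `x_mul_monomial_of_neg` and
    -- `y_mul_monomial_of_pos`, moved onto M through σ^j.
    (weightedShift k 1 fun n => if 0 ≤ n then 1 else (σ ^ (j - n)) a)
    (weightedShift k (-1) fun n => if n ≤ 0 then 1 else (σ ^ (j - n + 1)) a)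
    (by
      ext n m : 2
      simp only [LinearMap.comp_apply, Module.End.mul_apply, Finsupp.lsingle_apply,
        weightedShift_single, AlgHom.ofLinearMap_apply, LinearMap.coe_mk, AddHom.coe_mk, smul_smul]
      rcases le_or_gt 0 n with h | h
      · rw [if_neg (by lia), if_pos h]
        simp [show j - (n + 1) + 1 = j - n by lia]
      · rw [if_pos (by lia), if_neg (by lia)]
        simp)
    (by
      ext n m : 2
      simp only [LinearMap.comp_apply, Module.End.mul_apply, Finsupp.lsingle_apply,
        weightedShift_single, AlgHom.ofLinearMap_apply, LinearMap.coe_mk, AddHom.coe_mk, smul_smul,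
        ← AlgEquiv.mul_apply, ← zpow_add_one]
      rcases le_or_gt n 0 with h | h
      · rw [if_neg (by lia), if_pos h]
        simp [show j - (n + -1) = j - n + 1 by lia]
      · rw [if_pos (by lia), if_neg (by lia)]
        simp)
    (fun r => by
      ext n m : 2
      simp only [LinearMap.comp_apply, Module.End.mul_apply, Finsupp.lsingle_apply,
        weightedShift_single, AlgHom.ofLinearMap_apply, LinearMap.coe_mk, AddHom.coe_mk, smul_smul,
        ← AlgEquiv.mul_apply, ← zpow_add_one]
      simp [show j - (n + 1) + 1 = j - n by lia, mul_comm])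
    (fun r => by
      ext n m : 2
      simp only [LinearMap.comp_apply, Module.End.mul_apply, Finsupp.lsingle_apply,
        weightedShift_single, AlgHom.ofLinearMap_apply, LinearMap.coe_mk, AddHom.coe_mk, smul_smul,
        ← AlgEquiv.mul_apply, ← zpow_add_one]
      simp [show j - (n + -1) = j - n + 1 by lia, mul_comm])

/-- The k-structure on M is only auxiliary: it is restricted from R, so the resulting instance
depends on the R-module alone. -/
noncomputable instance [Module R M] : Module (BavulaAlgebra σ a) (BavulaInduced σ a j M) :=
  letI : Module k M := Module.compHom M (algebraMap k R)
  haveI : IsScalarTower k R M := ⟨fun c r m => by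
    rw [Algebra.smul_def, mul_smul]; rfl⟩
  Module.compHom (ℤ →₀ M) (action σ a j M).toRingHom

end Module

variable [Module R M]

theorem coeff_smul_e (r : R) (n : ℤ) (m : M) :
    BavulaAlgebra.coeff σ a r • e σ a j n m = e σ a j n ((σ ^ (j - n)) r • m) := by
  let : Module k M := Module.compHom M (algebraMap k R)
  have : IsScalarTower k R M := ⟨fun c r m => by rw [Algebra.smul_def, mul_smul]; rfl⟩
  change action σ a j M (BavulaAlgebra.coeff σ a r) (Finsupp.single n m) = Finsupp.single n _
  simp [action]

theorem x_smul_e (n : ℤ) (m : M) :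
    BavulaAlgebra.x σ a • e σ a j n m =
      e σ a j (n + 1) ((if 0 ≤ n then 1 else (σ ^ (j - n)) a) • m) := by
  let : Module k M := Module.compHom M (algebraMap k R)
  have : IsScalarTower k R M := ⟨fun c r m => by rw [Algebra.smul_def, mul_smul]; rfl⟩
  change action σ a j M (BavulaAlgebra.x σ a) (Finsupp.single n m) = Finsupp.single _ _
  simp [action]

theorem y_smul_e (n : ℤ) (m : M) :
    BavulaAlgebra.y σ a • e σ a j n m =
      e σ a j (n - 1) ((if n ≤ 0 then 1 else (σ ^ (j - n + 1)) a) • m) := by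
  let : Module k M := Module.compHom M (algebraMap k R)
  have : IsScalarTower k R M := ⟨fun c r m => by rw [Algebra.smul_def, mul_smul]; rfl⟩
  change action σ a j M (BavulaAlgebra.y σ a) (Finsupp.single n m) = Finsupp.single _ _
  simp [action, sub_eq_add_neg]

theorem x_smul_e_of_nonneg {n : ℤ} (hn : 0 ≤ n) (m : M) :
    BavulaAlgebra.x σ a • e σ a j n m = e σ a j (n + 1) m := by
  rw [x_smul_e, if_pos hn, one_smul]

theorem x_smul_e_of_neg {n : ℤ} (hn : n < 0) (m : M) :
    BavulaAlgebra.x σ a • e σ a j n m = e σ a j (n + 1) ((σ ^ (j - n)) a • m) := by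
  rw [x_smul_e, if_neg (by lia)]

theorem y_smul_e_of_nonpos {n : ℤ} (hn : n ≤ 0) (m : M) :
    BavulaAlgebra.y σ a • e σ a j n m = e σ a j (n - 1) m := by
  rw [y_smul_e, if_pos hn, one_smul]

theorem y_smul_e_of_pos {n : ℤ} (hn : 0 < n) (m : M) :
    BavulaAlgebra.y σ a • e σ a j n m = e σ a j (n - 1) ((σ ^ (j - n + 1)) a • m) := by
  rw [y_smul_e, if_neg (by lia)]

theorem monomial_smul_e_zero (n : ℤ) (m : M) :
    BavulaAlgebra.monomial σ a n • e σ a j 0 m = e σ a j n m := by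
  obtain ⟨i, rfl | rfl⟩ := n.eq_nat_or_neg
  · induction i with
    | zero => simp
    | succ i ih =>
      rw [Nat.cast_succ, ← BavulaAlgebra.x_mul_monomial_of_nonneg σ a (by lia), mul_smul, ih,
        x_smul_e_of_nonneg (by lia)]
  · induction i with
    | zero => simp
    | succ i ih =>
      rw [show -((i + 1 : ℕ) : ℤ) = -(i : ℤ) - 1 by lia,
        ← BavulaAlgebra.y_mul_monomial_of_nonpos σ a (by lia), mul_smul, ih,
        y_smul_e_of_nonpos (by lia)]

theorem monomial_smul_e_one (n : ℤ) (m : M) :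
    BavulaAlgebra.monomial σ a n • e σ a j 1 m =
      e σ a j (n + 1) (if 0 ≤ n then m else (σ ^ j) a • m) := by
  split_ifs with hn
  · rw [← monomial_smul_e_zero (n + 1), BavulaAlgebra.monomial_add_one σ a hn, mul_smul,
      x_smul_e_of_nonneg le_rfl, zero_add]
  · have := BavulaAlgebra.monomial_sub_one σ a (n := n + 1) (by lia)
    rw [add_sub_cancel_right] at this
    rw [this, mul_smul, y_smul_e_of_pos one_pos, sub_self, monomial_smul_e_zero, sub_add_cancel]

theorem monomial_smul_e_neg_one (n : ℤ) (m : M) :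
    BavulaAlgebra.monomial σ a n • e σ a j (-1) m =
      e σ a j (n - 1) (if n ≤ 0 then m else (σ ^ (j + 1)) a • m) := by
  split_ifs with hn
  · rw [← monomial_smul_e_zero (n - 1), BavulaAlgebra.monomial_sub_one σ a hn, mul_smul,
      y_smul_e_of_nonpos le_rfl, zero_sub]
  · have := BavulaAlgebra.monomial_add_one σ a (n := n - 1) (by lia)
    rw [sub_add_cancel] at this
    rw [this, mul_smul, x_smul_e_of_neg (by lia), neg_add_cancel, monomial_smul_e_zero,
      sub_neg_eq_add]

section Lift

variable {N : Type*} [AddCommGroup N] [Module (BavulaAlgebra σ a) N]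

/-- The universal property of an induced module. -/
noncomputable def lift (φ : M →+ N)
    (hφ : ∀ (r : R) m, φ ((σ ^ j) r • m) = BavulaAlgebra.coeff σ a r • φ m) :
    BavulaInduced σ a j M →ₗ[BavulaAlgebra σ a] N :=
  have h (r : R) (i : ℤ) (m : M) :
      φ ((σ ^ (j + i)) r • m) = BavulaAlgebra.coeff σ a ((σ ^ i) r) • φ m := by
    rw [zpow_add, AlgEquiv.mul_apply, hφ]
  have he (n : ℤ) (m : M) : addLift (fun n =>
      (DistribSMul.toAddMonoidHom N (BavulaAlgebra.monomial σ a n)).comp φ) (e σ a j n m) =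
        BavulaAlgebra.monomial σ a n • φ m :=
    addLift_e _ _ _
  BavulaAlgebra.linearMapOfGenerators
    (addLift fun n => (DistribSMul.toAddMonoidHom N (BavulaAlgebra.monomial σ a n)).comp φ)
    (fun r v => by
      induction v using induction_e with
      | hadd v w hv hw => rw [smul_add, map_add, map_add, smul_add, hv, hw]
      | he n m =>
        rw [coeff_smul_e, he, he, sub_eq_add_neg, h, ← mul_smul, ← mul_smul,
          BavulaAlgebra.coeff_mul_monomial])
    (fun v => by
      induction v using induction_e with
      | hadd v w hv hw => rw [smul_add, map_add, map_add, smul_add, hv, hw]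
      | he n m =>
        rcases le_or_gt 0 n with hn | hn
        · rw [x_smul_e_of_nonneg hn, he, he, ← mul_smul,
            BavulaAlgebra.x_mul_monomial_of_nonneg σ a hn]
        · rw [x_smul_e_of_neg hn, he, he, sub_eq_add_neg, h, ← mul_smul, ← mul_smul,
            BavulaAlgebra.x_mul_monomial_of_neg σ a hn])
    (fun v => by
      induction v using induction_e with
      | hadd v w hv hw => rw [smul_add, map_add, map_add, smul_add, hv, hw]
      | he n m =>
        rcases le_or_gt n 0 with hn | hn
        · rw [y_smul_e_of_nonpos hn, he, he, ← mul_smul,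
            BavulaAlgebra.y_mul_monomial_of_nonpos σ a hn]
        · rw [y_smul_e_of_pos hn, he, he, show j - n + 1 = j + (1 - n) by lia, h, ← mul_smul,
            ← mul_smul, BavulaAlgebra.y_mul_monomial_of_pos σ a hn])

@[simp]
theorem lift_e (φ : M →+ N)
    (hφ : ∀ (r : R) m, φ ((σ ^ j) r • m) = BavulaAlgebra.coeff σ a r • φ m) (n : ℤ) (m : M) :
    lift φ hφ (e σ a j n m) = BavulaAlgebra.monomial σ a n • φ m :=
  addLift_e _ _ _

theorem linearMap_ext {f g : BavulaInduced σ a j M →ₗ[BavulaAlgebra σ a] N}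
    (h : ∀ m, f (e σ a j 0 m) = g (e σ a j 0 m)) : f = g := by
  ext v
  induction v using induction_e with
  | hadd v w hv hw => rw [map_add, map_add, hv, hw]
  | he n m => rw [← monomial_smul_e_zero, map_smul, map_smul, h]

end Lift

end BavulaInduced

/-! ### The canonical complex of a module over a Bavula algebra -/

namespace BavulaInduced

variable {k : Type u} {R : Type v} [CommRing k] [CommRing R] [Algebra k R]
  {σ : R ≃ₐ[k] R} {a : R} {M : Type*} [AddCommGroup M] [Module R M] [Module (BavulaAlgebra σ a) M]
  (hM : ∀ (r : R) (m : M), r • m = BavulaAlgebra.coeff σ a r • m)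

/-- The action of `x` as an additive map. -/
noncomputable abbrev actX (σ : R ≃ₐ[k] R) (a : R) (M : Type*) [AddCommGroup M]
    [Module (BavulaAlgebra σ a) M] : M →+ M :=
  DistribSMul.toAddMonoidHom M (BavulaAlgebra.x σ a)

/-- The action of `y` as an additive map. -/
noncomputable abbrev actY (σ : R ≃ₐ[k] R) (a : R) (M : Type*) [AddCommGroup M]
    [Module (BavulaAlgebra σ a) M] : M →+ M :=
  DistribSMul.toAddMonoidHom M (BavulaAlgebra.y σ a)

include hM

theorem x_smul_smul (r : R) (m : M) :
    BavulaAlgebra.x σ a • r • m = σ r • BavulaAlgebra.x σ a • m := by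
  rw [hM, hM, ← mul_smul, ← mul_smul, BavulaAlgebra.x_mul_coeff]

theorem y_smul_smul (r : R) (m : M) :
    BavulaAlgebra.y σ a • σ r • m = r • BavulaAlgebra.y σ a • m := by
  rw [hM, hM, ← mul_smul, ← mul_smul, BavulaAlgebra.coeff_mul_y]

theorem y_smul_x_smul (m : M) : BavulaAlgebra.y σ a • BavulaAlgebra.x σ a • m = a • m := by
  rw [hM, ← mul_smul, BavulaAlgebra.y_mul_x]

theorem x_smul_y_smul (m : M) : BavulaAlgebra.x σ a • BavulaAlgebra.y σ a • m = σ a • m := by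
  rw [hM, ← mul_smul, BavulaAlgebra.x_mul_y]

/-- The augmentation of the module induced from `M`. -/
noncomputable def augmentation : BavulaInduced σ a 0 M →ₗ[BavulaAlgebra σ a] M :=
  lift (AddMonoidHom.id M) (by simp [hM])

@[simp]
theorem augmentation_e (n : ℤ) (m : M) :
    augmentation hM (e σ a 0 n m) = BavulaAlgebra.monomial σ a n • m := by
  simp [augmentation]

theorem augmentation_surjective : Function.Surjective (augmentation hM) :=
  fun m => ⟨e σ a 0 0 m, by simp⟩

/-- The map sending `m` to `x ⊗ m - 1 ⊗ x m`. -/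
noncomputable def diffX : BavulaInduced σ a (-1) M →ₗ[BavulaAlgebra σ a] BavulaInduced σ a 0 M :=
  -- The twist by −1 is forced by r x = x σ⁻¹(r); dually, r y = y σ(r) gives the twist by 1 in
  -- `diffY`.
  lift (e σ a 0 1 - (e σ a 0 0).comp (actX σ a M)) (fun r m => by
    simp [smul_sub, coeff_smul_e, x_smul_smul hM])

/-- The map sending `m` to `y ⊗ m - 1 ⊗ y m`. -/
noncomputable def diffY : BavulaInduced σ a 1 M →ₗ[BavulaAlgebra σ a] BavulaInduced σ a 0 M :=
  lift (e σ a 0 (-1) - (e σ a 0 0).comp (actY σ a M)) (fun r m => by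
    simp [smul_sub, coeff_smul_e, y_smul_smul hM])

theorem diffX_e (n : ℤ) (m : M) : diffX hM (e σ a (-1) n m) =
    e σ a 0 (n + 1) (if 0 ≤ n then m else a • m) - e σ a 0 n (BavulaAlgebra.x σ a • m) := by
  simp [diffX, smul_sub, monomial_smul_e_one, monomial_smul_e_zero]

theorem diffY_e (n : ℤ) (m : M) : diffY hM (e σ a 1 n m) =
    e σ a 0 (n - 1) (if n ≤ 0 then m else σ a • m) - e σ a 0 n (BavulaAlgebra.y σ a • m) := by
  simp [diffY, smul_sub, monomial_smul_e_neg_one, monomial_smul_e_zero]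

theorem coord_diffX (v : BavulaInduced σ a (-1) M) (i : ℤ) : coord σ a 0 i (diffX hM v) =
    (if 1 ≤ i then coord σ a (-1) (i - 1) v else a • coord σ a (-1) (i - 1) v) -
      BavulaAlgebra.x σ a • coord σ a (-1) i v := by
  induction v using induction_e with
  | hadd v w hv hw =>
    simp only [map_add, hv, hw, smul_add]
    split_ifs <;> abel
  | he n m =>
    simp only [diffX_e, map_sub, coord_e, smul_ite, smul_zero]
    grind only

theorem coord_diffY (v : BavulaInduced σ a 1 M) (i : ℤ) : coord σ a 0 i (diffY hM v) =
    (if i ≤ -1 then coord σ a 1 (i + 1) v else σ a • coord σ a 1 (i + 1) v) -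
      BavulaAlgebra.y σ a • coord σ a 1 i v := by
  induction v using induction_e with
  | hadd v w hv hw =>
    simp only [map_add, hv, hw, smul_add]
    split_ifs <;> abel
  | he n m =>
    simp only [diffY_e, map_sub, coord_e, smul_ite, smul_zero]
    grind only

/-- The map sending `m` to `1 ⊗ y m - y ⊗ m`. -/
noncomputable def relX : BavulaInduced σ a 0 M →ₗ[BavulaAlgebra σ a] BavulaInduced σ a (-1) M :=
  lift ((e σ a (-1) 0).comp (actY σ a M) - e σ a (-1) (-1)) (fun r m => by
    have := y_smul_smul hM (σ.symm r) m
    rw [AlgEquiv.apply_symm_apply] at this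
    simp [smul_sub, coeff_smul_e, this])

/-- The map sending `m` to `x ⊗ m - 1 ⊗ x m`. -/
noncomputable def relY : BavulaInduced σ a 0 M →ₗ[BavulaAlgebra σ a] BavulaInduced σ a 1 M :=
  lift (e σ a 1 1 - (e σ a 1 0).comp (actX σ a M)) (fun r m => by
    simp [smul_sub, coeff_smul_e, x_smul_smul hM])

theorem relX_e (n : ℤ) (m : M) : relX hM (e σ a 0 n m) =
    e σ a (-1) n (BavulaAlgebra.y σ a • m) - e σ a (-1) (n - 1) (if n ≤ 0 then m else a • m) := by
  simp [relX, smul_sub, monomial_smul_e_neg_one, monomial_smul_e_zero]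

theorem relY_e (n : ℤ) (m : M) : relY hM (e σ a 0 n m) =
    e σ a 1 (n + 1) (if 0 ≤ n then m else σ a • m) - e σ a 1 n (BavulaAlgebra.x σ a • m) := by
  simp [relY, smul_sub, monomial_smul_e_one, monomial_smul_e_zero]

theorem coord_relX (v : BavulaInduced σ a 0 M) (i : ℤ) : coord σ a (-1) i (relX hM v) =
    BavulaAlgebra.y σ a • coord σ a 0 i v -
      (if i ≤ -1 then coord σ a 0 (i + 1) v else a • coord σ a 0 (i + 1) v) := by
  induction v using induction_e with
  | hadd v w hv hw =>
    simp only [map_add, hv, hw, smul_add]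
    split_ifs <;> abel
  | he n m =>
    simp only [relX_e, map_sub, coord_e, smul_ite, smul_zero]
    grind only

theorem coord_relY (v : BavulaInduced σ a 0 M) (i : ℤ) : coord σ a 1 i (relY hM v) =
    (if 1 ≤ i then coord σ a 0 (i - 1) v else σ a • coord σ a 0 (i - 1) v) -
      BavulaAlgebra.x σ a • coord σ a 0 i v := by
  induction v using induction_e with
  | hadd v w hv hw =>
    simp only [map_add, hv, hw, smul_add]
    split_ifs <;> abel
  | he n m =>
    simp only [relY_e, map_sub, coord_e, smul_ite, smul_zero]
    grind only

/-- The differential presenting the kernel of the augmentation. -/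
noncomputable def diff : BavulaInduced σ a (-1) M × BavulaInduced σ a 1 M →ₗ[BavulaAlgebra σ a]
    BavulaInduced σ a 0 M :=
  (diffX hM).coprod (diffY hM)

/-- The differential given by the relation `x y - y x = σ a - a`. -/
noncomputable def rel : BavulaInduced σ a 0 M →ₗ[BavulaAlgebra σ a]
    BavulaInduced σ a (-1) M × BavulaInduced σ a 1 M :=
  (relX hM).prod (relY hM)

omit hM in
/-- The additive map inducing the embedding of `M` into the cokernel of `rel`. -/
noncomputable def embAux (σ : R ≃ₐ[k] R) (a : R) (M : Type*) [AddCommGroup M] [Module R M]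
    [Module (BavulaAlgebra σ a) M] : M →+ BavulaInduced σ a (-1) M × BavulaInduced σ a 1 M :=
  (e σ a (-1) (-1)).prod ((e σ a 1 0).comp (actX σ a M))

omit hM in
theorem embAux_apply (m : M) :
    embAux σ a M m = (e σ a (-1) (-1) m, e σ a 1 0 (BavulaAlgebra.x σ a • m)) := rfl

/-- Leading coefficients: far out w vanishes, and each component of `rel` has one side on which it
shifts w with weight 1. This one statement yields injectivity of both `rel` and `emb`. -/
theorem eq_zero_of_rel_eq_embAux {w : BavulaInduced σ a 0 M} {m : M}
    (h : rel hM w = embAux σ a M m) : w = 0 ∧ m = 0 := by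
  have h1 : relX hM w = e σ a (-1) (-1) m := congrArg Prod.fst h
  have h2 : relY hM w = e σ a 1 0 (BavulaAlgebra.x σ a • m) := congrArg Prod.snd h
  have hpos (n : ℤ) (hn : 0 ≤ n) : coord σ a 0 n w = 0 := by
    refine coord_eq_zero_of_nonneg (fun n hn hw => ?_) n hn
    have := congrArg (coord σ a 1 (n + 1)) h2
    rw [coord_relY, if_pos (by lia), coord_e, if_neg (by lia), hw, smul_zero, sub_zero] at this
    simpa using this
  have hneg (n : ℤ) (hn : n ≤ 0) : coord σ a 0 n w = 0 := by
    refine coord_eq_zero_of_nonpos (fun n hn hw => ?_) n hn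
    rcases hn.eq_or_lt with rfl | hn'
    -- Degree 0 must come from the second component: the first component in degree −1 also contains
    -- m.
    · exact hpos 0 le_rfl
    have := congrArg (coord σ a (-1) (n - 1)) h1
    rw [coord_relX, if_pos (by lia), coord_e, if_neg (by lia), hw, smul_zero, zero_sub,
      neg_eq_zero] at this
    simpa using this
  have hw : w = 0 := ext_coord fun n => by
    rw [map_zero]
    exact (le_total 0 n).elim (hpos n) (hneg n)
  refine ⟨hw, ?_⟩
  have := congrArg (coord σ a (-1) (-1)) h1
  simpa [hw, eq_comm] using this

theorem rel_injective : Function.Injective (rel hM) :=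
  (injective_iff_map_eq_zero _).mpr fun w hw =>
    (eq_zero_of_rel_eq_embAux hM (m := 0) (by rw [hw, map_zero])).1

theorem diff_rel (w : BavulaInduced σ a 0 M) : diff hM (rel hM w) = 0 := by
  suffices (diff hM).comp (rel hM) = 0 from LinearMap.congr_fun this w
  refine linearMap_ext fun m => ?_
  simp [diff, rel, relX_e, relY_e, diffX_e, diffY_e, x_smul_y_smul hM, y_smul_x_smul hM]
  abel

theorem diff_embAux (m : M) : diff hM (embAux σ a M m) = 0 := by
  simp [diff, embAux_apply, diffX_e, diffY_e, y_smul_x_smul hM]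

theorem augmentation_diff (v : BavulaInduced σ a (-1) M × BavulaInduced σ a 1 M) :
    augmentation hM (diff hM v) = 0 := by
  suffices (augmentation hM).comp (diff hM) = 0 from LinearMap.congr_fun this v
  refine LinearMap.prod_ext (linearMap_ext fun m => ?_) (linearMap_ext fun m => ?_)
  · simp [diff, diffX_e, BavulaAlgebra.monomial]
  · simp [diff, diffY_e, BavulaAlgebra.monomial]

/-- Modulo the image of `diff`, a factor x or y next to the tensor sign can be moved across it, so
everything collapses to degree 0. -/
theorem exists_eq_diff_add (w : BavulaInduced σ a 0 M) :
    ∃ v, w = diff hM v + e σ a 0 0 (augmentation hM w) := by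
  induction w using induction_e with
  | hadd w w' h h' =>
    obtain ⟨v, hv⟩ := h
    obtain ⟨v', hv'⟩ := h'
    refine ⟨v + v', ?_⟩
    simp only [map_add]
    nth_rw 1 [hv, hv']
    abel
  | he n m =>
    obtain ⟨i, rfl | rfl⟩ := n.eq_nat_or_neg
    · induction i generalizing m with
      | zero => exact ⟨0, by simp⟩
      | succ i ih =>
        obtain ⟨v, hv⟩ := ih (BavulaAlgebra.x σ a • m)
        refine ⟨v + (e σ a (-1) i m, 0), ?_⟩
        rw [augmentation_e, ← mul_smul, ← BavulaAlgebra.monomial_add_one σ a (by lia)] at hv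
        rw [augmentation_e, Nat.cast_succ, map_add, add_right_comm, ← hv]
        simp [diff, diffX_e]
    · induction i generalizing m with
      | zero => exact ⟨0, by simp⟩
      | succ i ih =>
        obtain ⟨v, hv⟩ := ih (BavulaAlgebra.y σ a • m)
        refine ⟨v + (0, e σ a 1 (-i) m), ?_⟩
        rw [augmentation_e, ← mul_smul, ← BavulaAlgebra.monomial_sub_one σ a (by lia)] at hv
        rw [augmentation_e, show -((i + 1 : ℕ) : ℤ) = -(i : ℤ) - 1 by lia, map_add, add_right_comm,
          ← hv]
        simp [diff, diffY_e]

/-- Every element of the middle term is, modulo the images of `rel` and `embAux`, supported in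
nonnegative degrees in its first component and in nonpositive degrees in its second. -/
theorem exists_eq_rel_add_embAux_add (g : BavulaInduced σ a (-1) M × BavulaInduced σ a 1 M) :
    ∃ w m s, g = rel hM w + embAux σ a M m + s ∧ (∀ i < 0, coord σ a (-1) i s.1 = 0) ∧
      ∀ i > 0, coord σ a 1 i s.2 = 0 := by
  let p (g : BavulaInduced σ a (-1) M × BavulaInduced σ a 1 M) : Prop :=
    ∃ w m s, g = rel hM w + embAux σ a M m + s ∧ (∀ i < 0, coord σ a (-1) i s.1 = 0) ∧
      ∀ i > 0, coord σ a 1 i s.2 = 0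
  have hadd (g g') (h : p g) (h' : p g') : p (g + g') := by
    obtain ⟨w, m, s, rfl, h1, h2⟩ := h
    obtain ⟨w', m', s', rfl, h1', h2'⟩ := h'
    refine ⟨w + w', m + m', s + s', by simp only [map_add]; abel, fun i hi => ?_, fun i hi => ?_⟩
    · rw [Prod.fst_add, map_add, h1 i hi, h1' i hi, add_zero]
    · rw [Prod.snd_add, map_add, h2 i hi, h2' i hi, add_zero]
  have hrel (w) : p (rel hM w) := ⟨w, 0, 0, by simp⟩
  have hemb (m) : p (embAux σ a M m) := ⟨0, m, 0, by simp⟩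
  have hsub (g g') (h : p g) (h' : p g') : p (g - g') := by
    rw [sub_eq_add_neg]
    refine hadd _ _ h ?_
    obtain ⟨w, m, s, rfl, h1, h2⟩ := h'
    exact ⟨-w, -m, -s, by simp only [map_neg]; abel, fun i hi => by simp [h1 i hi],
      fun i hi => by simp [h2 i hi]⟩
  have hX (n : ℤ) (hn : 0 ≤ n) (m : M) : p (e σ a (-1) n m, 0) :=
    ⟨0, 0, _, by simp only [map_zero, zero_add]; rfl,
      fun i hi => by rw [coord_e, if_neg (by lia)], fun i hi => by simp⟩
  have hY (n : ℤ) (hn : n ≤ 0) (m : M) : p (0, e σ a 1 n m) :=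
    ⟨0, 0, _, by simp only [map_zero, zero_add]; rfl,
      fun i hi => by simp, fun i hi => by rw [coord_e, if_neg (by lia)]⟩
  have hX1 (m : M) : p (e σ a (-1) (-1) m, 0) := by
    have := hsub _ _ (hemb m) (hY 0 le_rfl (BavulaAlgebra.x σ a • m))
    simpa [embAux_apply] using this
  -- Degree −1 is reached through `embAux`, all lower degrees through `rel`. Its other terms lie in
  -- degrees already treated, or in nonpositive degrees of the second component.
  have hXn (i : ℕ) (m : M) : p (e σ a (-1) (-i) m, 0) ∧ p (e σ a (-1) (-i - 1) m, 0) := by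
    induction i generalizing m with
    | zero => exact ⟨hX _ (by simp) m, by simpa using hX1 m⟩
    | succ i ih =>
      rw [show -((i + 1 : ℕ) : ℤ) = -(i : ℤ) - 1 by lia]
      refine ⟨(ih m).2, ?_⟩
      have h1 := hrel (e σ a 0 (-(i : ℤ) - 1) m)
      have h2 := hsub _ _ (ih (BavulaAlgebra.y σ a • m)).2 h1
      have h3 := hadd _ _ h2 (hsub _ _ (hY (-i) (by lia) (σ a • m))
        (hY (-i - 1) (by lia) (BavulaAlgebra.x σ a • m)))
      convert h3 using 1
      rw [show rel hM _ = (relX hM _, relY hM _) from rfl, relX_e, relY_e, if_pos (by lia),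
        if_neg (by lia), sub_add_cancel]
      simp
  have hYn (i : ℕ) (m : M) : p (0, e σ a 1 i m) ∧ p (0, e σ a 1 (i + 1) m) := by
    induction i generalizing m with
    | zero =>
      refine ⟨hY _ (by simp) m, ?_⟩
      have h := hsub _ _ (hadd _ _ (hadd _ _ (hrel (e σ a 0 0 m)) (hX1 m))
        (hY 0 le_rfl (BavulaAlgebra.x σ a • m))) (hX 0 le_rfl (BavulaAlgebra.y σ a • m))
      convert h using 1
      rw [show rel hM _ = (relX hM _, relY hM _) from rfl, relX_e, relY_e, if_pos le_rfl,
        if_pos le_rfl]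
      simp
    | succ i ih =>
      rw [Nat.cast_succ]
      refine ⟨(ih m).2, ?_⟩
      have h1 := hadd _ _ (hrel (e σ a 0 ((i : ℤ) + 1) m)) (ih (BavulaAlgebra.x σ a • m)).2
      have h2 := hsub _ _ (hadd _ _ h1 (hX i (by lia) (a • m)))
        (hX (i + 1) (by lia) (BavulaAlgebra.y σ a • m))
      convert h2 using 1
      rw [show rel hM _ = (relX hM _, relY hM _) from rfl, relX_e, relY_e, if_neg (by lia),
        if_pos (by lia), add_sub_cancel_right]
      simp
  change p g
  rw [← Prod.fst_add_snd g]
  refine hadd _ _ ?_ ?_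
  · induction g.1 using induction_e with
    | hadd v w hv hw =>
      have := hadd _ _ hv hw
      simpa using this
    | he n m =>
      obtain ⟨i, rfl | rfl⟩ := n.eq_nat_or_neg
      · exact hX i (by lia) m
      · exact (hXn i m).1
  · induction g.2 using induction_e with
    | hadd v w hv hw =>
      have := hadd _ _ hv hw
      simpa using this
    | he n m =>
      obtain ⟨i, rfl | rfl⟩ := n.eq_nat_or_neg
      · exact (hYn i m).1
      · exact hY (-i) (by lia) m

/-- On such normal forms the two components do not interact at the ends: in positive degrees only
`diffX` contributes, in negative degrees only `diffY`, each shifting with weight 1. Outermost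
coefficients therefore vanish one after another. -/
theorem eq_zero_of_diff_eq_zero {s : BavulaInduced σ a (-1) M × BavulaInduced σ a 1 M}
    (h1 : ∀ i < 0, coord σ a (-1) i s.1 = 0) (h2 : ∀ i > 0, coord σ a 1 i s.2 = 0)
    (h : diff hM s = 0) : s = 0 := by
  have h' (i : ℤ) : coord σ a 0 i (diffX hM s.1) + coord σ a 0 i (diffY hM s.2) = 0 := by
    rw [← map_add]
    exact (congrArg (coord σ a 0 i) h).trans (map_zero _)
  have hX (n : ℤ) (hn : 0 ≤ n) : coord σ a (-1) n s.1 = 0 := by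
    refine coord_eq_zero_of_nonneg (fun n hn hs => ?_) n hn
    have := h' (n + 1)
    rw [coord_diffX, coord_diffY, hs, h2 (n + 1) (by lia), h2 (n + 1 + 1) (by lia),
      if_pos (by lia)] at this
    simpa using this
  have hY (n : ℤ) (hn : n ≤ 0) : coord σ a 1 n s.2 = 0 := by
    refine coord_eq_zero_of_nonpos (fun n hn hs => ?_) n hn
    have := h' (n - 1)
    rw [coord_diffX, coord_diffY, hs, h1 (n - 1) (by lia), h1 (n - 1 - 1) (by lia),
      if_pos (show n - 1 ≤ -1 by lia)] at this
    simpa using this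
  refine Prod.ext (ext_coord fun n => ?_) (ext_coord fun n => ?_)
  · rw [Prod.fst_zero, map_zero]
    exact (lt_or_ge n 0).elim (h1 n) (hX n)
  · rw [Prod.snd_zero, map_zero]
    exact (lt_or_ge 0 n).elim (h2 n) (hY n)

/-- The normal form of a cycle is itself a cycle, hence zero: the middle homology is represented by
`embAux`. -/
theorem exists_eq_rel_add_embAux {g : BavulaInduced σ a (-1) M × BavulaInduced σ a 1 M}
    (hg : diff hM g = 0) : ∃ w m, g = rel hM w + embAux σ a M m := by
  obtain ⟨w, m, s, rfl, h1, h2⟩ := exists_eq_rel_add_embAux_add hM g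
  refine ⟨w, m, ?_⟩
  rw [map_add, map_add, diff_rel, diff_embAux, zero_add, zero_add] at hg
  rw [eq_zero_of_diff_eq_zero hM h1 h2 hg, add_zero]

/-- The embedding of `M` into the cokernel of `rel`. -/
noncomputable def emb : M →ₗ[BavulaAlgebra σ a]
    (BavulaInduced σ a (-1) M × BavulaInduced σ a 1 M) ⧸ LinearMap.range (rel hM) :=
  BavulaAlgebra.linearMapOfGenerators
    ((LinearMap.range (rel hM)).mkQ.toAddMonoidHom.comp (embAux σ a M))
    (fun r m => by
      refine congrArg (LinearMap.range (rel hM)).mkQ ?_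
      rw [embAux_apply, embAux_apply, ← hM, x_smul_smul hM]
      beta_reduce
      rw [Prod.smul_mk, coeff_smul_e, coeff_smul_e]
      simp)
    (fun m => by
      -- `embAux` commutes with x only up to the boundary `rel (1 ⊗ x m)`, and with y only up to
      -- `-rel (y ⊗ m)`; hence the quotient.
      refine (Submodule.Quotient.eq' _).mpr ⟨e σ a 0 0 (BavulaAlgebra.x σ a • m), ?_⟩
      rw [embAux_apply, embAux_apply, show rel hM _ = (relX hM _, relY hM _) from rfl, relX_e,
        relY_e]
      beta_reduce
      rw [Prod.smul_mk, x_smul_e_of_neg (by lia), x_smul_e_of_nonneg le_rfl,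
        y_smul_x_smul hM]
      simp [sub_eq_add_neg, add_comm])
    (fun m => by
      refine (Submodule.Quotient.eq' _).mpr ⟨-e σ a 0 (-1) m, ?_⟩
      rw [embAux_apply, embAux_apply, map_neg, show rel hM _ = (relX hM _, relY hM _) from rfl,
        relX_e, relY_e]
      beta_reduce
      rw [Prod.smul_mk, y_smul_e_of_nonpos (by lia), y_smul_e_of_nonpos le_rfl,
        x_smul_y_smul hM]
      simp [sub_eq_add_neg, add_comm])

theorem emb_apply (m : M) : emb hM m = (LinearMap.range (rel hM)).mkQ (embAux σ a M m) := rfl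

theorem emb_injective : Function.Injective (emb hM) := by
  refine (injective_iff_map_eq_zero _).mpr fun m hm => ?_
  rw [emb_apply, Submodule.mkQ_apply, Submodule.Quotient.mk_eq_zero] at hm
  obtain ⟨w, hw⟩ := hm
  exact (eq_zero_of_rel_eq_embAux hM hw).2

/-- The surjection from the cokernel of `rel` to the kernel of the augmentation. -/
noncomputable def toKer : ((BavulaInduced σ a (-1) M × BavulaInduced σ a 1 M) ⧸
    LinearMap.range (rel hM)) →ₗ[BavulaAlgebra σ a] LinearMap.ker (augmentation hM) :=
  (LinearMap.range (rel hM)).liftQ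
    ((diff hM).codRestrict (LinearMap.ker (augmentation hM)) (augmentation_diff hM)) (by
      rintro _ ⟨w, rfl⟩
      exact Subtype.ext (diff_rel hM w))

theorem toKer_surjective : Function.Surjective (toKer hM) := by
  rintro ⟨w, hw⟩
  obtain ⟨v, hv⟩ := exists_eq_diff_add hM w
  rw [LinearMap.mem_ker.mp hw, map_zero, add_zero] at hv
  exact ⟨(LinearMap.range (rel hM)).mkQ v, Subtype.ext hv.symm⟩

theorem emb_exact_toKer : Function.Exact (emb hM) (toKer hM) := by
  intro c
  constructor
  · obtain ⟨g, rfl⟩ := Submodule.mkQ_surjective _ c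
    intro hg
    obtain ⟨w, m, rfl⟩ := exists_eq_rel_add_embAux hM (congrArg Subtype.val hg)
    refine ⟨m, ?_⟩
    rw [emb_apply, map_add, right_eq_add]
    exact (Submodule.Quotient.mk_eq_zero _).mpr ⟨w, rfl⟩
  · rintro ⟨m, rfl⟩
    exact Subtype.ext (diff_embAux hM m)

end BavulaInduced

/-! ### Submodules of projective modules over a principal ideal domain -/

section PrincipalIdealRing

variable {R : Type u} [CommRing R]

/-- A divisible module over a principal ideal domain satisfies Baer's criterion. -/
theorem Module.Baer.of_forall_exists_smul_eq [IsPrincipalIdealRing R] {Q : Type v} [AddCommGroup Q] [Module R Q]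
    (hQ : ∀ r : R, r ≠ 0 → ∀ q : Q, ∃ q', r • q' = q) : Module.Baer R Q := by
  intro I g
  obtain ⟨d, rfl⟩ := (IsPrincipalIdealRing.principal I).principal
  rcases eq_or_ne d 0 with rfl | hd
  · refine ⟨0, fun x hx => ?_⟩
    have : (⟨x, hx⟩ : Submodule.span R {(0 : R)}) = 0 := Subtype.ext (by simpa using hx)
    rw [this, map_zero, LinearMap.zero_apply]
  · obtain ⟨q, hq⟩ := hQ d hd (g ⟨d, Submodule.mem_span_singleton_self d⟩)
    refine ⟨LinearMap.toSpanSingleton R Q q, fun x hx => ?_⟩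
    obtain ⟨c, rfl⟩ := Submodule.mem_span_singleton.mp hx
    rw [LinearMap.toSpanSingleton_apply, smul_assoc, hq, ← map_smul]
    rfl

/-- An injective module over a domain is divisible. -/
theorem Module.Injective.exists_smul_eq [IsDomain R] {Q : Type u} [AddCommGroup Q] [Module R Q]
    [Module.Injective R Q] {r : R} (hr : r ≠ 0) (q : Q) : ∃ q', r • q' = q := by
  obtain ⟨h, hh⟩ := Module.Injective.extension_property R Q R R
    (LinearMap.toSpanSingleton R R r) (fun x y hxy => mul_right_cancel₀ hr (by simpa using hxy))
    (LinearMap.toSpanSingleton R Q q)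
  refine ⟨h 1, ?_⟩
  have := LinearMap.congr_fun hh 1
  rw [← map_smul]
  simpa using this

/-- Submodules of projective modules over a principal ideal domain are projective. -/
theorem Module.Projective.submodule [IsDomain R] [IsPrincipalIdealRing R]
    {P : Type u} [AddCommGroup P] [Module R P]
    [Module.Projective R P] (K : Submodule R P) : Module.Projective R K := by
  refine Module.Projective.of_lifting_property fun {A B} _ _ _ _ f g hf => ?_
  -- Embed A in an injective J. The quotient J/C by the image C of ker f is divisible, hence
  -- injective, so g, viewed in J/C, extends from K to P and then lifts to J because P is
  -- projective.
  let J := Injective.under (ModuleCat.of R A)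
  let ι : A →ₗ[R] J := (Injective.ι (ModuleCat.of R A)).hom
  have hι : Function.Injective ι := (ModuleCat.mono_iff_injective _).mp inferInstance
  have : CategoryTheory.Injective (ModuleCat.of R J) :=
    inferInstanceAs (CategoryTheory.Injective (Injective.under (ModuleCat.of R A)))
  have : Module.Injective R J := Module.injective_module_of_injective_object R J
  let C := (LinearMap.ker f).map ι
  have : Module.Injective R (J ⧸ C) := by
    refine Module.Baer.injective (Module.Baer.of_forall_exists_smul_eq fun r hr q => ?_)
    obtain ⟨q, rfl⟩ := C.mkQ_surjective q
    obtain ⟨q', rfl⟩ := Module.Injective.exists_smul_eq hr q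
    exact ⟨C.mkQ q', (map_smul _ _ _).symm⟩
  let β : B →ₗ[R] J ⧸ C := (C.mapQ C LinearMap.id le_rfl).comp
    (((LinearMap.ker f).mapQ C ι (Submodule.le_comap_map _ _)).comp
      (f.quotKerEquivOfSurjective hf).symm.toLinearMap)
  have hβ (x : A) : β (f x) = C.mkQ (ι x) := by
    have : (f.quotKerEquivOfSurjective hf).symm (f x) = (LinearMap.ker f).mkQ x := by
      rw [LinearEquiv.symm_apply_eq]
      rfl
    simp [β, this]
  obtain ⟨h, hh⟩ := Module.Injective.extension_property R (J ⧸ C) K P K.subtype K.injective_subtype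
    (β.comp g)
  obtain ⟨l, hl⟩ := Module.projective_lifting_property C.mkQ h C.mkQ_surjective
  -- On K the lift to J lands in A: it differs from any preimage of g x by an element of ι(ker f).
  have key (x : K) : ∃ y : A, ι y = l x ∧ f y = g x := by
    obtain ⟨y, hy⟩ := hf (g x)
    have h1 : C.mkQ (l x) = C.mkQ (ι y) := by
      rw [← hβ, hy]
      exact (LinearMap.congr_fun hl (x : P)).trans (LinearMap.congr_fun hh x)
    obtain ⟨z, hz, hz'⟩ := (Submodule.Quotient.eq C).mp h1
    refine ⟨y + z, by rw [map_add, hz']; abel, by rw [map_add, hy, LinearMap.mem_ker.mp hz, add_zero]⟩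
  choose s hs hs' using key
  refine ⟨⟨⟨s, fun x y => hι ?_⟩, fun r x => hι ?_⟩, LinearMap.ext hs'⟩
  · simp [hs]
  · simp [hs]

end PrincipalIdealRing

/-! ### Projectivity of induced modules -/

section Semilinear

variable {R : Type u} [CommRing R]

/-- The lifting property of projective modules for maps that are linear up to an automorphism of
the ring. -/
theorem Module.projective_lifting_property_twist {P N N' : Type*} [AddCommGroup P] [Module R P]
    [Module.Projective R P] [AddCommGroup N] [AddCommGroup N'] (τ : R ≃+* R)
    (ρ : R →+* AddMonoid.End N) (ρ' : R →+* AddMonoid.End N') (f : N' →+ N)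
    (hf : ∀ r n, f (ρ' r n) = ρ r (f n)) (hsurj : Function.Surjective f) (φ : P →+ N)
    (hφ : ∀ r p, φ (τ r • p) = ρ r (φ p)) :
    ∃ ψ : P →+ N', (∀ r p, ψ (τ r • p) = ρ' r (ψ p)) ∧ ∀ p, f (ψ p) = φ p := by
  -- Twisting the targets by τ⁻¹ turns semilinear maps into linear ones.
  let : Module R N := Module.compHom N (ρ.comp τ.symm.toRingHom)
  let : Module R N' := Module.compHom N' (ρ'.comp τ.symm.toRingHom)
  let f' : N' →ₗ[R] N := { f with map_smul' := fun r n => hf (τ.symm r) n }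
  let φ' : P →ₗ[R] N := { φ with
    map_smul' := fun r p => by
      have := hφ (τ.symm r) p
      rwa [τ.apply_symm_apply] at this }
  obtain ⟨ψ, hψ⟩ := Module.projective_lifting_property f' φ' hsurj
  refine ⟨ψ.toAddMonoidHom, fun r p => ?_, fun p => LinearMap.congr_fun hψ p⟩
  refine (ψ.map_smul (τ r) p).trans ?_
  change ρ' (τ.symm (τ r)) (ψ p) = _
  rw [τ.symm_apply_apply]
  rfl

end Semilinear

namespace BavulaInduced

variable {k R : Type u} [CommRing k] [CommRing R] [Algebra k R]
  {σ : R ≃ₐ[k] R} {a : R} {j : ℤ}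

/-- The ring homomorphism giving the action of the coefficients on a module. -/
noncomputable def coeffAction (σ : R ≃ₐ[k] R) (a : R) (N : Type*) [AddCommGroup N]
    [Module (BavulaAlgebra σ a) N] : R →+* AddMonoid.End N :=
  (Module.toAddMonoidEnd (BavulaAlgebra σ a) N).comp (BavulaAlgebra.coeff σ a).toRingHom

theorem coeffAction_apply (N : Type*) [AddCommGroup N] [Module (BavulaAlgebra σ a) N] (r : R)
    (n : N) : coeffAction σ a N r n = BavulaAlgebra.coeff σ a r • n := rfl

/-- The module induced from a projective module is projective. -/
instance projective {P : Type u} [AddCommGroup P] [Module R P] [Module.Projective R P] :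
    Module.Projective (BavulaAlgebra σ a) (BavulaInduced σ a j P) := by
  refine Module.Projective.of_lifting_property fun {N' N} _ _ _ _ f g hf => ?_
  obtain ⟨ψ, hψ, hψ'⟩ := Module.projective_lifting_property_twist (σ ^ j).toRingEquiv
    (coeffAction σ a N) (coeffAction σ a N') f.toAddMonoidHom (fun r n => f.map_smul _ n) hf
    (g.toAddMonoidHom.comp (e σ a j 0)) (fun r p => by
      rw [coeffAction_apply]
      refine Eq.trans ?_ (g.map_smul _ _)
      rw [coeff_smul_e, sub_zero]
      rfl)
  refine ⟨lift ψ hψ, linearMap_ext fun m => ?_⟩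
  have h := lift_e (σ := σ) (a := a) (j := j) ψ hψ 0 m
  rw [BavulaAlgebra.monomial_zero, one_smul] at h
  exact (congrArg f h).trans (hψ' m)

/-- The module induced from a projective module is projective over the coefficients. -/
theorem projective_coeff {P : Type u} [AddCommGroup P] [Module R P] [Module.Projective R P]
    [Module R (BavulaInduced σ a j P)]
    (h : ∀ (r : R) (v : BavulaInduced σ a j P), r • v = BavulaAlgebra.coeff σ a r • v) :
    Module.Projective R (BavulaInduced σ a j P) := by
  refine Module.Projective.of_lifting_property fun {N' N} _ _ _ _ f g hf => ?_
  -- Over R the induced module is the direct sum of the twists of P by σ^(j − n), so lifting is done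
  -- degree by degree.
  have key (n : ℤ) : ∃ ψ : P →+ N', (∀ (r : R) p, ψ ((σ ^ (j - n)) r • p) = r • ψ p) ∧
      ∀ p, f (ψ p) = g (e σ a j n p) :=
    Module.projective_lifting_property_twist (σ ^ (j - n)).toRingEquiv
      (Module.toAddMonoidEnd R N) (Module.toAddMonoidEnd R N') f.toAddMonoidHom
      (fun r n => f.map_smul _ n) hf (g.toAddMonoidHom.comp (e σ a j n)) (fun r p => by
        refine Eq.trans ?_ (g.map_smul _ _)
        rw [h, coeff_smul_e]
        rfl)
  choose ψ hψ hψ' using key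
  refine ⟨{ addLift ψ with map_smul' := fun r v => ?_ }, LinearMap.ext fun v => ?_⟩
  · change addLift ψ (r • v) = r • addLift ψ v
    induction v using induction_e with
    | hadd v w hv hw => rw [smul_add, map_add, map_add, smul_add, hv, hw]
    | he n m => rw [h, coeff_smul_e, addLift_e, addLift_e, hψ]
  · change f (addLift ψ v) = g v
    induction v using induction_e with
    | hadd v w hv hw => rw [map_add, map_add, map_add, hv, hw]
    | he n m => rw [addLift_e, hψ']

end BavulaInduced

/-! ### The upper bound for the global dimension -/

namespace BavulaAlgebra

open BavulaInduced

theorem shortExact_of_exact {A : Type u} [Ring A] {M N L : Type u} [AddCommGroup M]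
    [AddCommGroup N] [AddCommGroup L] [Module A M] [Module A N] [Module A L] {f : M →ₗ[A] N}
    {g : N →ₗ[A] L} (hf : Function.Injective f) (hfg : Function.Exact f g)
    (hg : Function.Surjective g) :
    (ModuleCat.shortComplexOfCompEqZero f g hfg.linearMap_comp_eq_zero).ShortExact :=
  ModuleCat.shortComplex_shortExact _ hfg hf hg

section Periodic

variable {k R : Type u} [CommRing k] [CommRing R] [Algebra k R]
  {σ : R ≃ₐ[k] R} {a : R} {M : Type u} [AddCommGroup M] [Module R M] [Module (BavulaAlgebra σ a) M]

/-- For a module that is projective over the coefficients, finiteness of the projective dimension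
allows to lower the projective dimension by periodicity. -/
theorem hasProjectiveDimensionLT_of_projective_coeff [Module.Projective R M]
    (hM : ∀ (r : R) (m : M), r • m = coeff σ a r • m) (n : ℕ)
    (h : HasProjectiveDimensionLT (ModuleCat.of (BavulaAlgebra σ a) M) n) :
    HasProjectiveDimensionLT (ModuleCat.of (BavulaAlgebra σ a) M) 2 := by
  induction n using Nat.strong_induction_on with
  | _ n ih =>
  rcases le_or_gt n 2 with hn | hn
  · exact hasProjectiveDimensionLT_of_ge _ n 2 hn
  obtain ⟨i, rfl⟩ : ∃ i, n = i + 3 := ⟨n - 3, by lia⟩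
  have hI : Projective (ModuleCat.of (BavulaAlgebra σ a) (BavulaInduced σ a 0 M)) :=
    ModuleCat.projective_of_categoryTheory_projective _
  have hG : Projective (ModuleCat.of (BavulaAlgebra σ a)
      (BavulaInduced σ a (-1) M × BavulaInduced σ a 1 M)) :=
    ModuleCat.projective_of_categoryTheory_projective _
  have hK : HasProjectiveDimensionLT (ModuleCat.of (BavulaAlgebra σ a)
      (LinearMap.ker (augmentation hM))) (i + 2) :=
    (LinearMap.shortExact_shortComplexKer (augmentation_surjective hM)).hasProjectiveDimensionLT_X₁
      (i + 2) (hasProjectiveDimensionLT_of_ge _ 1 _ (by lia)) h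
  have hC : HasProjectiveDimensionLT (ModuleCat.of (BavulaAlgebra σ a)
      ((BavulaInduced σ a (-1) M × BavulaInduced σ a 1 M) ⧸ LinearMap.range (rel hM))) 2 :=
    (shortExact_of_exact (rel_injective hM) (LinearMap.exact_map_mkQ_range (rel hM))
      (Submodule.mkQ_surjective _)).hasProjectiveDimensionLT_X₃ 1
      (inferInstanceAs (HasProjectiveDimensionLT (ModuleCat.of _ (BavulaInduced σ a 0 M)) 1))
      (hasProjectiveDimensionLT_of_ge
        (ModuleCat.of _ (BavulaInduced σ a (-1) M × BavulaInduced σ a 1 M)) 1 2 (by lia))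
  -- K is a syzygy of M and M is the kernel of C → K, so the bound i + 3 drops to i + 1; the floor 2
  -- is the bound for C.
  refine ih (max 2 (i + 1)) (by lia) ?_
  exact (shortExact_of_exact (emb_injective hM) (emb_exact_toKer hM)
    (toKer_surjective hM)).hasProjectiveDimensionLT_X₁ _
      (hasProjectiveDimensionLT_of_ge (ModuleCat.of (BavulaAlgebra σ a)
        ((BavulaInduced σ a (-1) M × BavulaInduced σ a 1 M) ⧸ LinearMap.range (rel hM))) 2 _
          (by lia))
      (hasProjectiveDimensionLT_of_ge (ModuleCat.of (BavulaAlgebra σ a)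
        (LinearMap.ker (augmentation hM))) (i + 2) _ (by lia))

end Periodic

/-- If the global dimension of a Bavula algebra over a principal ideal domain is finite, then it is
at most two. -/
theorem globalDimension_le_two {k R : Type u} [CommRing k] [CommRing R] [IsDomain R]
    [IsPrincipalIdealRing R] [Algebra k R] (σ : R ≃ₐ[k] R) (a : R)
    (h : globalDimension (BavulaAlgebra σ a) < ⊤) : globalDimension (BavulaAlgebra σ a) ≤ 2 := by
  refine iSup_le fun N => (projectiveDimension_le_iff N 2).mpr ?_
  let : Module R N := Module.compHom N (coeff σ a).toRingHom
  have hN (r : R) (n : N) : r • n = coeff σ a r • n := rfl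
  let P := N →₀ R
  let φ : P →ₗ[R] N := Finsupp.linearCombination R id
  have hφ : Function.Surjective φ := fun n => ⟨Finsupp.single n 1, by
    rw [Finsupp.linearCombination_single, one_smul, id]⟩
  let π : BavulaInduced σ a 0 P →ₗ[BavulaAlgebra σ a] N :=
    BavulaInduced.lift (φ : P →+ N) (fun r m => by
      rw [zpow_zero, ← hN]
      exact φ.map_smul r m)
  have hπ : Function.Surjective π := fun n => by
    obtain ⟨p, rfl⟩ := hφ n
    exact ⟨e σ a 0 0 p, by simp [π]⟩
  let : Module R (BavulaInduced σ a 0 P) := Module.compHom _ (coeff σ a).toRingHom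
  have hI : Module.Projective R (BavulaInduced σ a 0 P) := projective_coeff fun r v => rfl
  let : Module R (LinearMap.ker π) := Module.compHom _ (coeff σ a).toRingHom
  have hK : Module.Projective R (LinearMap.ker π) :=
    let K : Submodule R (BavulaInduced σ a 0 P) :=
      { (LinearMap.ker π).toAddSubgroup with
        smul_mem' := fun r v hv => (LinearMap.ker π).smul_mem (coeff σ a r) hv }
    Module.Projective.submodule K
  -- Finite global dimension is needed only here, to start the descent for the R-projective module
  -- ker π.
  have hfin : projectiveDimension (ModuleCat.of (BavulaAlgebra σ a) (LinearMap.ker π)) ≠ ⊤ :=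
    ((le_iSup (fun M : ModuleCat.{u} (BavulaAlgebra σ a) => projectiveDimension M) _).trans_lt
      h).ne
  obtain ⟨n, hn⟩ := (projectiveDimension_ne_top_iff _).mp hfin
  have hK2 := hasProjectiveDimensionLT_of_projective_coeff (M := LinearMap.ker π)
    (fun r v => rfl) (n + 1) hn
  have hI2 : Projective (ModuleCat.of (BavulaAlgebra σ a) (BavulaInduced σ a 0 P)) :=
    ModuleCat.projective_of_categoryTheory_projective _
  exact (LinearMap.shortExact_shortComplexKer hπ).hasProjectiveDimensionLT_X₃ 2 hK2
    (hasProjectiveDimensionLT_of_ge (ModuleCat.of (BavulaAlgebra σ a) (BavulaInduced σ a 0 P))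
      1 3 (by lia))

end BavulaAlgebra

/-! ### The lower bound for the global dimension -/

namespace BavulaInduced

variable {k : Type u} {R : Type v} [CommRing k] [CommRing R] [Algebra k R]
  {σ : R ≃ₐ[k] R} {a : R} {j : ℤ} {M : Type*} [AddCommGroup M] [Module R M]

theorem coord_coeff_smul (r : R) (v : BavulaInduced σ a j M) (i : ℤ) :
    coord σ a j i (BavulaAlgebra.coeff σ a r • v) = (σ ^ (j - i)) r • coord σ a j i v := by
  induction v using induction_e with
  | hadd v w hv hw => rw [smul_add, map_add, map_add, smul_add, hv, hw]
  | he n m =>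
    rw [coeff_smul_e, coord_e, coord_e]
    split_ifs with h
    · rw [h]
    · rw [smul_zero]

theorem coord_x_smul (v : BavulaInduced σ a j M) (i : ℤ) :
    coord σ a j (i + 1) (BavulaAlgebra.x σ a • v) =
      (if 0 ≤ i then 1 else (σ ^ (j - i)) a) • coord σ a j i v := by
  induction v using induction_e with
  | hadd v w hv hw => rw [smul_add, map_add, map_add, smul_add, hv, hw]
  | he n m =>
    rw [x_smul_e, coord_e, coord_e]
    rcases eq_or_ne n i with h | h
    · rw [if_pos (by lia), if_pos h, h]
    · rw [if_neg (by lia), if_neg h, smul_zero]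

omit [Module R M] in
theorem mem_of_forall_e_coord_mem {S : AddSubgroup (BavulaInduced σ a j M)}
    {v : BavulaInduced σ a j M} (h : ∀ n, e σ a j n (coord σ a j n v) ∈ S) : v ∈ S := by
  have : v = ∑ n ∈ Finsupp.support v, e σ a j n (coord σ a j n v) := (Finsupp.sum_single v).symm
  rw [this]
  exact S.sum_mem fun n _ => h n

end BavulaInduced

namespace BavulaAlgebra

open BavulaInduced

/-! ### Coordinates of elements of the algebra. -/

section Regular

variable {k : Type u} {R : Type v} [CommRing k] [CommRing R] [Algebra k R]
  (σ : R ≃ₐ[k] R) (a : R)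

/-- The linear map from the module induced from the coefficients to the Bavula algebra. -/
noncomputable def ofInduced : BavulaInduced σ a 0 R →ₗ[BavulaAlgebra σ a] BavulaAlgebra σ a :=
  BavulaInduced.lift (coeff σ a : R →+ BavulaAlgebra σ a) (fun r s => by
    rw [zpow_zero]
    exact map_mul (coeff σ a) r s)

/-- Acting on the generator 1 ⊗ 1 is thus injective, which lets elements of the algebra be compared
through coordinates in R. -/
theorem ofInduced_smul_e (b : BavulaAlgebra σ a) : ofInduced σ a (b • e σ a 0 0 1) = b := by
  rw [map_smul, ofInduced, lift_e, monomial_zero, one_smul]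
  exact (congrArg (b * ·) (map_one (coeff σ a))).trans (mul_one b)

/-- In coordinates, left multiplication by r is multiplication by powers of σ applied to r, nonzero
elements of a domain. -/
theorem coeff_mul_left_cancel [IsDomain R] {r : R} (hr : r ≠ 0) {b c : BavulaAlgebra σ a}
    (h : coeff σ a r * b = coeff σ a r * c) : b = c := by
  rw [← ofInduced_smul_e σ a b, ← ofInduced_smul_e σ a c]
  refine congrArg _ (ext_coord fun n => ?_)
  have := congrArg (fun d => coord σ a 0 n (d • e σ a 0 0 (1 : R))) h
  simp only [mul_smul, coord_coeff_smul, smul_eq_mul] at this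
  exact mul_left_cancel₀ (by simpa using hr) this

end Regular

/-! ### The character at h = 0 and its kernel. -/

section Quantum

variable {k : Type u} [Field k] (q : k) (hq : q ≠ 0) (a : k[X])

theorem sigmaQ_X : sigmaQ q hq X = C q * X := by simp [sigmaQ]

theorem sigmaQ_zpow_C (n : ℤ) (c : k) : (sigmaQ q hq ^ n) (C c) = C c :=
  (sigmaQ q hq ^ n).commutes c

theorem sigmaQ_zpow_X (n : ℤ) : (sigmaQ q hq ^ n) X = C (q ^ n) * X := by
  have h (i : ℕ) : (sigmaQ q hq ^ (i : ℤ)) X = C (q ^ (i : ℤ)) * X := by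
    induction i with
    | zero => simp
    | succ i ih =>
      rw [Nat.cast_succ, zpow_add_one, AlgEquiv.mul_apply, sigmaQ_X, map_mul, sigmaQ_zpow_C, ih,
        zpow_add_one₀ hq, ← mul_assoc, ← C_mul, mul_comm q]
  obtain ⟨i, rfl | rfl⟩ := n.eq_nat_or_neg
  · exact h i
  · apply (sigmaQ q hq ^ (i : ℤ)).injective
    rw [map_mul, sigmaQ_zpow_C, h, ← mul_assoc, ← C_mul, ← zpow_add₀ hq, ← AlgEquiv.mul_apply,
      ← zpow_add]
    simp

theorem eval_sigmaQ (p : k[X]) : (sigmaQ q hq p).eval 0 = p.eval 0 := by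
  have : (aeval (0 : k)).comp (sigmaQ q hq : k[X] →ₐ[k] k[X]) = aeval (0 : k) := by
    ext
    simp [sigmaQ_X]
  exact AlgHom.congr_fun this p

/-- The character of the quantum Bavula algebra sending `h` to `0` and `x` to `1`. -/
noncomputable def character : BavulaAlgebra (sigmaQ q hq) a →ₐ[k] k :=
  lift (sigmaQ q hq) a (aeval (0 : k)) 1 (a.eval 0)
    (by simp [coe_aeval_eq_eval]) (by simp [coe_aeval_eq_eval, eval_sigmaQ])
    (by simp [coe_aeval_eq_eval, eval_sigmaQ])
    (by simp [coe_aeval_eq_eval, eval_sigmaQ, mul_comm])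

theorem character_coeff (p : k[X]) :
    character q hq a (coeff (sigmaQ q hq) a p) = p.eval 0 :=
  lift_coeff _ _ _ _ _ _ p

theorem character_x : character q hq a (x (sigmaQ q hq) a) = 1 :=
  lift_x _ _ _ _ _ _

/-- Evaluate coordinates at 0. The right side dies, and degree n + 1 expresses q times the value of
b in that degree as a multiple of its value in degree n. As b vanishes in very negative degrees, all
values are 0, so h divides each coordinate. -/
theorem exists_eq_coeff_X_mul {b c : BavulaAlgebra (sigmaQ q hq) a}
    (h : (x (sigmaQ q hq) a - coeff (sigmaQ q hq) a (C q)) * b = coeff (sigmaQ q hq) a X * c) :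
    ∃ d, b = coeff (sigmaQ q hq) a X * d := by
  set w := b • e (sigmaQ q hq) a 0 0 (1 : k[X])
  have hstep (n : ℤ) (hn : (coord (sigmaQ q hq) a 0 n w).eval 0 = 0) :
      (coord (sigmaQ q hq) a 0 (n + 1) w).eval 0 = 0 := by
    have := congrArg (fun d => (coord (sigmaQ q hq) a 0 (n + 1) (d • e (sigmaQ q hq) a 0 0 (1 : k[X]))).eval 0) h
    simp only [mul_smul, sub_smul, map_sub, coord_coeff_smul, coord_x_smul, smul_eq_mul] at this
    rw [sigmaQ_zpow_C, sigmaQ_zpow_X] at this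
    rw [eval_sub, eval_mul, show eval 0 (coord (sigmaQ q hq) a 0 n
      (b • e (sigmaQ q hq) a 0 0 (1 : k[X]))) = 0 from hn] at this
    simpa [w, hq] using this
  have hzero (n : ℤ) : (coord (sigmaQ q hq) a 0 n w).eval 0 = 0 := by
    obtain ⟨N, hN⟩ := exists_coord_eq_zero w
    have key (i : ℕ) : (coord (sigmaQ q hq) a 0 (-(N : ℤ) - |n| + i) w).eval 0 = 0 := by
      induction i with
      | zero =>
        rw [hN _ (by
          have := abs_nonneg n
          rw [abs_of_nonpos (by simp only [Nat.cast_zero]; lia)]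
          simp), eval_zero]
      | succ i ih =>
        rw [Nat.cast_succ, ← add_assoc]
        exact hstep _ ih
    have := key (N + |n| + n).toNat
    rwa [Int.toNat_of_nonneg (by have := neg_abs_le n; lia),
      show -(N : ℤ) - |n| + (N + |n| + n) = n by ring] at this
  have hw : w ∈ (DistribSMul.toAddMonoidHom (BavulaInduced (sigmaQ q hq) a 0 k[X]) (coeff (sigmaQ q hq) a X)).range := by
    refine mem_of_forall_e_coord_mem fun n => ?_
    obtain ⟨p, hp⟩ := X_dvd_iff.mpr ((coeff_zero_eq_eval_zero _).trans (hzero n))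
    -- In degree n, h acts as q^(-n) h; the factor q^n compensates.
    refine ⟨e (sigmaQ q hq) a 0 n (C (q ^ n) * p), ?_⟩
    rw [DistribSMul.toAddMonoidHom_apply, coeff_smul_e, sigmaQ_zpow_X, hp, zero_sub, zpow_neg,
      smul_eq_mul, mul_mul_mul_comm, ← C_mul, inv_mul_cancel₀ (zpow_ne_zero n hq), C_1, one_mul]
  obtain ⟨w', hw'⟩ := hw
  refine ⟨ofInduced (sigmaQ q hq) a w', ?_⟩
  rw [← ofInduced_smul_e (sigmaQ q hq) a b]
  exact (congrArg (ofInduced (sigmaQ q hq) a) hw').symm.trans (map_smul _ _ _)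

/-- The kernel of the character of a quantum Bavula algebra is not a projective left ideal. -/
theorem not_projective_ker_character :
    ¬ Module.Projective (BavulaAlgebra (sigmaQ q hq) a) (RingHom.ker (character q hq a)) := by
  intro hI
  set I := RingHom.ker (character q hq a)
  have hX : coeff (sigmaQ q hq) a X ∈ I := by
    rw [RingHom.mem_ker, character_coeff, eval_X]
  have hx : coeff (sigmaQ q hq) a (C q) * (x (sigmaQ q hq) a - 1) ∈ I := by
    rw [RingHom.mem_ker, map_mul, map_sub, map_one, character_x, sub_self, mul_zero]
  -- s splits the canonical map onto I from the free module on the elements of I.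
  obtain ⟨s, hs⟩ := hI.out
  have hrel : (x (sigmaQ q hq) a - coeff (sigmaQ q hq) a (C q)) * coeff (sigmaQ q hq) a X =
      coeff (sigmaQ q hq) a X * (coeff (sigmaQ q hq) a (C q) * (x (sigmaQ q hq) a - 1)) := by
    rw [sub_mul, x_mul_coeff, sigmaQ_X, map_mul, mul_sub, mul_sub, mul_one, ← mul_assoc,
      ← map_mul, ← map_mul, mul_comm X]
  have hrel' : (x (sigmaQ q hq) a - coeff (sigmaQ q hq) a (C q)) • s ⟨_, hX⟩ = coeff (sigmaQ q hq) a X • s ⟨_, hx⟩ := by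
    rw [← map_smul, ← map_smul]
    exact congrArg s (Subtype.ext hrel)
  have hdiv (i : I) : ∃ d, s ⟨_, hX⟩ i = coeff (sigmaQ q hq) a X * d :=
    exists_eq_coeff_X_mul q hq a (DFunLike.congr_fun hrel' i)
  choose d hd using hdiv
  -- Applying the canonical map to s(h), whose coordinates are h d i, gives h = h ∑ d i · i.
  have hsum : coeff (sigmaQ q hq) a X * 1 = coeff (sigmaQ q hq) a X * ∑ i ∈ (s ⟨_, hX⟩).support, d i * i.1 := by
    have h1 : Finsupp.linearCombination _ id (s ⟨_, hX⟩) = (⟨_, hX⟩ : I) := hs _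
    have h2 := congrArg Subtype.val h1
    rw [Finsupp.linearCombination_apply, Finsupp.sum, AddSubmonoidClass.coe_finsetSum] at h2
    rw [mul_one, Finset.mul_sum]
    refine h2.symm.trans ?_
    refine Finset.sum_congr rfl fun i _ => ?_
    rw [← mul_assoc, ← hd]
    rfl
  have hone : (1 : BavulaAlgebra (sigmaQ q hq) a) ∈ I := by
    rw [coeff_mul_left_cancel (sigmaQ q hq) a X_ne_zero hsum]
    exact I.sum_mem fun i _ => I.mul_mem_left _ i.2
  rw [RingHom.mem_ker, map_one] at hone
  exact one_ne_zero hone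

/-- The global dimension of a quantum Bavula algebra is at least two. -/
theorem two_le_globalDimension : 2 ≤ globalDimension (BavulaAlgebra (sigmaQ q hq) a) := by
  let I := RingHom.ker (character q hq a)
  refine le_trans ?_ (le_iSup
    (fun M : ModuleCat.{u} (BavulaAlgebra (sigmaQ q hq) a) => projectiveDimension M)
    (ModuleCat.of _ (BavulaAlgebra (sigmaQ q hq) a ⧸ I)))
  -- If Λ/I had projective dimension at most 1, its syzygy I would be projective.
  refine (projectiveDimension_ge_iff _ 2).mpr fun h => not_projective_ker_character q hq a ?_
  have hA : Projective (ModuleCat.of (BavulaAlgebra (sigmaQ q hq) a)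
      (BavulaAlgebra (sigmaQ q hq) a)) :=
    ModuleCat.projective_of_categoryTheory_projective _
  have hI : HasProjectiveDimensionLT (ModuleCat.of (BavulaAlgebra (sigmaQ q hq) a) I) 1 :=
    (shortExact_of_exact I.injective_subtype (LinearMap.exact_subtype_mkQ I)
      I.mkQ_surjective).hasProjectiveDimensionLT_X₁ 1
      (inferInstanceAs (HasProjectiveDimensionLT
        (ModuleCat.of _ (BavulaAlgebra (sigmaQ q hq) a)) 1)) h
  exact (IsProjective.iff_projective I).mpr
    (projective_iff_hasProjectiveDimensionLT_one.mpr hI)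

end Quantum

end BavulaAlgebra

theorem mainTheorem4 {k : Type u} [Field k] [CharZero k] (q : k) (hq0 : q ≠ 0) (hq1 : q ≠ 1)
    (a : k[X]) :
    globalDimension (BavulaAlgebra (sigmaQ q hq0) a) < ⊤ →
      globalDimension (BavulaAlgebra (sigmaQ q hq0) a) = 2 := fun h =>
  le_antisymm (BavulaAlgebra.globalDimension_le_two _ a h)
    (BavulaAlgebra.two_le_globalDimension q hq0 a)
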